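/- Let $\mathcal G=([p],E)$ be a directed acyclic graph with parent sets $\mathrm{pa}(i)=\{j: j\to i\in E\}$ and families $\mathrm{fa}(i)=\{i\}\cup\mathrm{pa}(i)$. Let $\mathcal I=(I_0,I_1,\dots,I_K)$ with $I_k\subseteq[p]$ and $I_0=\emptyset$. The Gaussian interventional DAG model $\mathcal M(\mathcal G,\mathcal I)$ is the set of all tuples $(\Sigma^{(0)},\dots,\Sigma^{(K)})$ of covariance matrices $$\Sigma^{(k)}=(\mathrm I_p-\Lambda^{(k)})^{-1}\,\mathrm{diag}(\omega^{(k)})\,(\mathrm I_p-\Lambda^{(k)})^{-T},$$ where $\omega^{(k)}_i>0$ for all $i$, $\lambda^{(k)}_{ij}=0$ unless $j\to i\in E$, and, for all $k$ and all $i\notin I_k$, $\omega^{(k)}_i=\omega^{(0)}_i$ and $\lambda^{(k)}_{ij}=\lambda^{(0)}_{ij}$ for all $j$. (So $\Sigma^{(k)}$ is the covariance matrix of $X^{(k)}_i=\sum_{j\in\mathrm{pa}(i)}\lambda^{(k)}_{ij}X^{(k)}_j+\varepsilon^{(k)}_i$ with independent $\varepsilon^{(k)}_i\sim N(0,\omega^{(k)}_i)$.)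 Let $n_0,\dots,n_K\ge 1$. For data $x^k_1,\dots,x^k_{n_k}\in\mathbb R^p$ ($0\le k\le K$) the likelihood of $(\Sigma^{(0)},\dots,\Sigma^{(K)})\in\mathcal M(\mathcal G,\mathcal I)$ is $\prod_{k=0}^K\prod_{j=1}^{n_k}f_{\Sigma^{(k)}}(x^k_j)$, with $f_\Sigma$ the density of $N(0,\Sigma)$, and a maximum likelihood estimate (MLE) is a point of $\mathcal M(\mathcal G,\mathcal I)$ at which it attains its maximum over $\mathcal M(\mathcal G,\mathcal I)$. For $A\subseteq\{0,\dots,K\}$ let $S^{\mathrm{pool}(A)}=\big(\sum_{k\in A}n_k\big)^{-1}\sum_{k\in A}\sum_{j=1}^{n_k}x^k_j(x^k_j)^T$, and let $S^{(k)}=S^{\mathrm{pool}(\{k\})}$ and $Z_i^c=\{k\in\{0,\dots,K\}: i\notin I_k\}$. For $B\subseteq[p]$ let $S_B$ be the submatrix with rows and columns in $B$, let $P_B=(S_B)^{-1}$ (with the superscript of $S$), and let $M^{\Phi}$ denote the $p\times p$ matrix obtained by padding the $B\times B$ matrix $M$ with zeros. Put $$\hat K^{(k)}=\sum_{i\notin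 I_k}\Big(\big(P^{\mathrm{pool}(Z_i^c)}_{\mathrm{fa}(i)}\big)^{\Phi}-\big(P^{\mathrm{pool}(Z_i^c)}_{\mathrm{pa}(i)}\big)^{\Phi}\Big)+\sum_{i\in I_k}\Big(\big(P^{(k)}_{\mathrm{fa}(i)}\big)^{\Phi}-\big(P^{(k)}_{\mathrm{pa}(i)}\big)^{\Phi}\Big).$$ 1. For all data such that $S^{\mathrm{pool}(Z_i^c)}_{\mathrm{fa}(i)}$ is positive definite for all $k$ and $i\notin I_k$, and $S^{(k)}_{\mathrm{fa}(i)}$ is positive definite for all $k$ and $i\in I_k$, the matrices $\hat K^{(k)}$ are positive definite and $\big((\hat K^{(0)})^{-1},\dots,(\hat K^{(K)})^{-1}\big)$ is the unique MLE. Now let the data be a random sample from some $(\Sigma^{(0)},\dots,\Sigma^{(K)})\in\mathcal M(\mathcal G,\mathcal I)$, i.e. the vectors $x^k_j$ are independent and $x^k_j\sim N(0,\Sigma^{(k)})$. 2. Almost surely, if $(\hat\Sigma^{(0)},\dots,\hat\Sigma^{(K)})$ is an MLE, then the matrices listed in 1 are positive definite, and every $\hat\Sigma^{(k)}$ is positive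 definite with $(\hat\Sigma^{(k)})^{-1}=\hat K^{(k)}$. 3. An MLE exists with probability one if and only if, for all $k\in\{0,\dots,K\}$, $n_k\ge|\mathrm{fa}(i)|$ for all $i\in I_k$ and $\sum_{l\in Z_i^c}n_l\ge|\mathrm{fa}(i)|$ for all $i\notin I_k$. -/

import Mathlib

open MeasureTheory ProbabilityTheory Matrix

noncomputable section

namespace GaussianIDAG

/-- A directed graph is acyclic if no vertex can be reached from itself by a nonempty
directed walk. In particular there are no loops. -/
def IsDAG {p : ℕ} (G : Digraph (Fin p)) : Prop :=
  ∀ v, ¬ Relation.TransGen G.Adj v v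

open scoped Classical in
/-- The parents `{j | j → i}` of `i`. -/
def pa {p : ℕ} (G : Digraph (Fin p)) (i : Fin p) : Finset (Fin p) :=
  Finset.univ.filter fun j => G.Adj j i

/-- The family `{i} ∪ pa(i)` of `i`. -/
def fa {p : ℕ} (G : Digraph (Fin p)) (i : Fin p) : Finset (Fin p) :=
  insert i (pa G i)

/-- `(Λ, ω)` are admissible parameters of the Gaussian DAG model of `G`: the coefficient
`Λ i j` of `X j` in the structural equation `X i = ∑ j, Λ i j * X j + ε i` vanishes unless `j → i`,
and the error variances `ω i` are positive. -/
def IsParam {p : ℕ} (G : Digraph (Fin p)) (L : Matrix (Fin p) (Fin p) ℝ) (w : Fin p → ℝ) : Prop :=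
  (∀ i j, ¬ G.Adj j i → L i j = 0) ∧ ∀ i, 0 < w i

/-- The covariance matrix of the solution `X` of `X = L X + ε`, where the coordinates of `ε` are
independent centred normal variables with variances `w i`. -/
def structuralCov {p : ℕ} (L : Matrix (Fin p) (Fin p) ℝ) (w : Fin p → ℝ) :
    Matrix (Fin p) (Fin p) ℝ :=
  (1 - L)⁻¹ * Matrix.diagonal w * ((1 - L)⁻¹)ᵀ

/-- The Gaussian interventional DAG model of `G` and the targets `I 0, …, I K`, in covariance
coordinates: in experiment `k` only the structural equations of the nodes in `I k` may differ
from those of the observational experiment `0`. -/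
def model {p K : ℕ} (G : Digraph (Fin p)) (I : Fin (K + 1) → Finset (Fin p)) :
    Set (Fin (K + 1) → Matrix (Fin p) (Fin p) ℝ) :=
  {S | ∃ (L : Fin (K + 1) → Matrix (Fin p) (Fin p) ℝ) (w : Fin (K + 1) → Fin p → ℝ),
    (∀ k, IsParam G (L k) (w k)) ∧
    (∀ k, ∀ i, i ∉ I k → (∀ j, L k i j = L 0 i j) ∧ w k i = w 0 i) ∧
    ∀ k, S k = structuralCov (L k) (w k)}

/-- Data: `D k j` is the `j`-th observed vector of the `k`-th experiment. -/
abbrev Data (p : ℕ) {K : ℕ} (n : Fin (K + 1) → ℕ) : Type :=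
  (k : Fin (K + 1)) → Fin (n k) → EuclideanSpace ℝ (Fin p)

/-- The density of the centred normal distribution with (positive definite) covariance `S`. -/
def gaussianDensity {p : ℕ} (S : Matrix (Fin p) (Fin p) ℝ) (x : EuclideanSpace ℝ (Fin p)) : ℝ :=
  (Real.sqrt ((2 * Real.pi) ^ p * S.det))⁻¹ *
    Real.exp (-(x.ofLp ⬝ᵥ (S⁻¹ *ᵥ x.ofLp)) / 2)

/-- The likelihood of the covariance parameters `S` given the data `D`. -/
def likelihood {p K : ℕ} {n : Fin (K + 1) → ℕ} (D : Data p n)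
    (S : Fin (K + 1) → Matrix (Fin p) (Fin p) ℝ) : ℝ :=
  ∏ k, ∏ j, gaussianDensity (S k) (D k j)

/-- `S` is a maximum likelihood estimate of the covariance parameters of the model. -/
def IsMLE {p K : ℕ} (G : Digraph (Fin p)) (I : Fin (K + 1) → Finset (Fin p))
    {n : Fin (K + 1) → ℕ} (D : Data p n) (S : Fin (K + 1) → Matrix (Fin p) (Fin p) ℝ) : Prop :=
  S ∈ model G I ∧ IsMaxOn (likelihood D) (model G I) S

/-- The (uncentred, since the model has mean zero) sample covariance matrix of the data pooled
over the experiments in `A`. -/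
def pooledCov {p K : ℕ} {n : Fin (K + 1) → ℕ} (D : Data p n) (A : Finset (Fin (K + 1))) :
    Matrix (Fin p) (Fin p) ℝ :=
  (∑ k ∈ A, (n k : ℝ))⁻¹ • ∑ k ∈ A, ∑ j, Matrix.vecMulVec (D k j).ofLp (D k j).ofLp

/-- The principal submatrix with rows and columns in `A`. -/
def principal {p : ℕ} (S : Matrix (Fin p) (Fin p) ℝ) (A : Finset (Fin p)) :
    Matrix {a // a ∈ A} {a // a ∈ A} ℝ :=
  S.submatrix Subtype.val Subtype.val

/-- The inverse of the principal submatrix on `A`, padded with zeros to a `p × p` matrix. -/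
def paddedInv {p : ℕ} (S : Matrix (Fin p) (Fin p) ℝ) (A : Finset (Fin p)) :
    Matrix (Fin p) (Fin p) ℝ :=
  fun a b => if h : a ∈ A ∧ b ∈ A then (principal S A)⁻¹ ⟨a, h.1⟩ ⟨b, h.2⟩ else 0

/-- The experiments that do not target `i`. -/
def nonTargeting {p K : ℕ} (I : Fin (K + 1) → Finset (Fin p)) (i : Fin p) :
    Finset (Fin (K + 1)) :=
  Finset.univ.filter fun k => i ∉ I k

/-- The explicit precision matrix of the `k`-th experiment. -/
def precisionHat {p K : ℕ} (G : Digraph (Fin p)) (I : Fin (K + 1) → Finset (Fin p))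
    {n : Fin (K + 1) → ℕ} (D : Data p n) (k : Fin (K + 1)) : Matrix (Fin p) (Fin p) ℝ :=
  (∑ i ∈ (I k)ᶜ, (paddedInv (pooledCov D (nonTargeting I i)) (fa G i)
      - paddedInv (pooledCov D (nonTargeting I i)) (pa G i)))
  + ∑ i ∈ I k, (paddedInv (pooledCov D {k}) (fa G i) - paddedInv (pooledCov D {k}) (pa G i))

/-- The marginal sample covariance matrices on families that enter `precisionHat` are positive
definite. Then so are those on the parent sets. -/
def FamilyPosDef {p K : ℕ} (G : Digraph (Fin p)) (I : Fin (K + 1) → Finset (Fin p))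
    {n : Fin (K + 1) → ℕ} (D : Data p n) : Prop :=
  ∀ k, (∀ i ∈ I k, (principal (pooledCov D {k}) (fa G i)).PosDef) ∧
    ∀ i, i ∉ I k → (principal (pooledCov D (nonTargeting I i)) (fa G i)).PosDef

end GaussianIDAG

end

/-! In the parameters (Λ, ω), minus twice the log-likelihood is a constant plus a sum of losses, one
for each node and experiment (`likelihood_structuralCov`). For a fixed node i, the experiments fall
into blocks sharing the same equation: all those not targeting i, and each targeting one alone. On a
block with N observations and pooled covariance S the loss is N(log v + q(a)/v), where q(a) is the
S-quadratic form of e_i - a (`sum_equationLoss`), and distinct blocks have independent parameters.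

If S is positive definite on fa(i), the block loss has a unique minimiser: the least squares
coefficients (`residualVar_le`) and the residual variance (`log_add_div_ge`). The resulting rank-one
term of the precision matrix is the difference of the padded inverses on fa(i) and pa(i)
(`paddedInv_insert_sub`), so the terms add up to `precisionHat`.

For random data, almost surely any at most |B| observations restricted to B are linearly independent
(`ae_inGeneralPosition`). Since |fa(i)| = |pa(i)| + 1, each block is then in one of two cases: N ≥
|fa(i)| and S is positive definite on fa(i) (`posDef_of_inGeneralPosition`), or N ≤ |pa(i)|, the
parents fit X_i exactly, and letting v tend to 0 makes the likelihood unbounded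
(`not_isMLE_of_exact_fit`). -/

namespace GaussianIDAG

/-! ### Principal submatrices and their zero-padded inverses -/

section PaddedInverse

variable {p : ℕ} {S : Matrix (Fin p) (Fin p) ℝ} {B : Finset (Fin p)}

lemma dotProduct_mulVec_comm_of_isSymm (hS : S.IsSymm) (x y : Fin p → ℝ) :
    x ⬝ᵥ (S *ᵥ y) = y ⬝ᵥ (S *ᵥ x) := by
  rw [dotProduct_mulVec, ← mulVec_transpose, hS.eq, dotProduct_comm]

lemma sum_coe_eq_sum_of_support {f : Fin p → ℝ} (hf : ∀ j, j ∉ B → f j = 0) :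
    ∑ j : {a // a ∈ B}, f j = ∑ j, f j := by
  rw [Finset.sum_coe_sort B f]
  exact Finset.sum_subset (Finset.subset_univ _) fun j _ hj => hf j hj

lemma quadForm_principal {v : Fin p → ℝ} (hv : ∀ j, j ∉ B → v j = 0) :
    (fun j : {a // a ∈ B} => v j) ⬝ᵥ (principal S B *ᵥ fun j => v j) = v ⬝ᵥ (S *ᵥ v) := by
  simp only [dotProduct, mulVec, principal, submatrix_apply]
  rw [sum_coe_eq_sum_of_support (f := fun i => v i * ∑ j : {a // a ∈ B}, S i j * v j)
    (fun j hj => by simp [hv j hj])]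
  refine Finset.sum_congr rfl fun i _ => ?_
  rw [sum_coe_eq_sum_of_support (f := fun j => S i j * v j) (fun j hj => by simp [hv j hj])]

lemma quadForm_pos (hS : (principal S B).PosDef) {v : Fin p → ℝ}
    (hv : ∀ j, j ∉ B → v j = 0) (hv0 : v ≠ 0) : 0 < v ⬝ᵥ (S *ᵥ v) := by
  rw [← quadForm_principal hv]
  refine hS.dotProduct_mulVec_pos fun h => hv0 ?_
  ext j
  by_cases hj : j ∈ B
  · exact congrFun h ⟨j, hj⟩
  · exact hv j hj

lemma posDef_principal_of_quadForm_pos (hS : S.IsSymm)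
    (h : ∀ v : Fin p → ℝ, (∀ j, j ∉ B → v j = 0) → v ≠ 0 → 0 < v ⬝ᵥ (S *ᵥ v)) :
    (principal S B).PosDef := by
  refine .of_dotProduct_mulVec_pos ?_ fun x hx => ?_
  · ext a b
    simpa [principal] using hS.apply a.1 b.1
  · set v : Fin p → ℝ := fun j => if hj : j ∈ B then x ⟨j, hj⟩ else 0 with hvdef
    have hv : ∀ j, j ∉ B → v j = 0 := fun j hj => by simp [hvdef, hj]
    have hxv : x = fun j : {a // a ∈ B} => v j := by
      ext j
      simp [hvdef]
    rw [star_trivial, hxv, quadForm_principal hv]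
    refine h v hv fun h0 => hx ?_
    rw [hxv, h0]
    rfl

lemma paddedInv_eq_zero {a b : Fin p} (h : a ∉ B ∨ b ∉ B) : paddedInv S B a b = 0 := by
  have : ¬ (a ∈ B ∧ b ∈ B) := by tauto
  simp [paddedInv, this]

lemma mul_apply_of_support {M : Matrix (Fin p) (Fin p) ℝ}
    (hM : ∀ a b, a ∉ B ∨ b ∉ B → M a b = 0) (a b : {a // a ∈ B}) :
    (principal S B * principal M B) a b = (S * M) a b := by
  simp only [mul_apply, principal, submatrix_apply]
  exact sum_coe_eq_sum_of_support (f := fun j => S a j * M j b)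
    (fun j hj => by simp [hM j b (Or.inl hj)])

lemma principal_paddedInv : principal (paddedInv S B) B = (principal S B)⁻¹ := by
  ext a b
  simp [principal, paddedInv]

lemma mul_paddedInv_apply (hS : (principal S B).PosDef) {a : Fin p} (ha : a ∈ B) (b : Fin p) :
    (S * paddedInv S B) a b = (1 : Matrix (Fin p) (Fin p) ℝ) a b := by
  by_cases hb : b ∈ B
  · have h := mul_apply_of_support (S := S) (M := paddedInv S B)
      (fun _ _ => paddedInv_eq_zero) ⟨a, ha⟩ ⟨b, hb⟩
    rw [principal_paddedInv, mul_nonsing_inv _ ((isUnit_iff_isUnit_det _).1 hS.isUnit)] at h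
    rw [← h, one_apply, one_apply]
    simp only [Subtype.mk.injEq]
  · have hab : a ≠ b := fun h => hb (h ▸ ha)
    rw [one_apply_ne hab, mul_apply]
    exact Finset.sum_eq_zero fun c _ => by rw [paddedInv_eq_zero (Or.inr hb), mul_zero]

/-- Uniqueness of right inverses: a padded inverse can be identified by checking the B×B block of a
full-size product. -/
lemma eq_paddedInv {M : Matrix (Fin p) (Fin p) ℝ} (hM : ∀ a b, a ∉ B ∨ b ∉ B → M a b = 0)
    (h : ∀ a ∈ B, ∀ b ∈ B, (S * M) a b = (1 : Matrix (Fin p) (Fin p) ℝ) a b) :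
    paddedInv S B = M := by
  have h1 : principal S B * principal M B = 1 := by
    ext a b
    rw [mul_apply_of_support hM, h a a.2 b b.2]
    simp only [one_apply, Subtype.ext_iff]
  have h2 := inv_eq_right_inv h1
  ext a b
  by_cases hab : a ∈ B ∧ b ∈ B
  · rw [paddedInv, dif_pos hab, h2]
    rfl
  · rw [paddedInv_eq_zero (by tauto), hM a b (by tauto)]

lemma paddedInv_isSymm (hS : (principal S B).PosDef) : (paddedInv S B).IsSymm := by
  refine IsSymm.ext fun a b => ?_
  by_cases hab : a ∈ B ∧ b ∈ B
  · have := hS.isHermitian.inv.apply ⟨a, hab.1⟩ ⟨b, hab.2⟩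
    simpa [paddedInv, hab] using this
  · rw [paddedInv_eq_zero (by tauto), paddedInv_eq_zero (by tauto)]

end PaddedInverse

/-! ### Least squares regression in terms of a covariance matrix -/

section Regression

variable {p : ℕ} {S : Matrix (Fin p) (Fin p) ℝ} {B : Finset (Fin p)} {i : Fin p}

/-- The coefficients of the structural equation `X i - ∑ j, a j * X j = ε`. -/
def equationRow {p : ℕ} (i : Fin p) (a : Fin p → ℝ) : Fin p → ℝ := Pi.single i 1 - a

/-- The coefficients of the least squares regression of coordinate `i` on the coordinates in `B`. -/
noncomputable def regressionCoeff {p : ℕ} (S : Matrix (Fin p) (Fin p) ℝ) (B : Finset (Fin p))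
    (i : Fin p) : Fin p → ℝ :=
  paddedInv S B *ᵥ fun j => S j i

/-- The residual variance of the least squares regression of coordinate `i` on those in `B`. -/
noncomputable def residualVar {p : ℕ} (S : Matrix (Fin p) (Fin p) ℝ) (B : Finset (Fin p))
    (i : Fin p) : ℝ :=
  equationRow i (regressionCoeff S B i) ⬝ᵥ (S *ᵥ equationRow i (regressionCoeff S B i))

lemma regressionCoeff_eq_zero {j : Fin p} (hj : j ∉ B) : regressionCoeff S B i j = 0 := by
  simp only [regressionCoeff, mulVec, dotProduct]
  exact Finset.sum_eq_zero fun c _ => by rw [paddedInv_eq_zero (Or.inl hj), zero_mul]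

lemma equationRow_eq_zero {a : Fin p → ℝ} (ha : ∀ j, j ∉ B → a j = 0) {j : Fin p}
    (hj : j ∉ insert i B) : equationRow i a j = 0 := by
  rw [Finset.mem_insert, not_or] at hj
  simp [equationRow, hj.1, ha j hj.2]

lemma equationRow_apply_self {a : Fin p → ℝ} (ha : a i = 0) : equationRow i a i = 1 := by
  simp [equationRow, ha]

lemma equationRow_ne_zero {a : Fin p → ℝ} (ha : a i = 0) : equationRow i a ≠ 0 := fun h => by
  have := congrFun h i
  rw [equationRow_apply_self ha] at this
  simp at this

lemma principal_posDef_of_subset {C : Finset (Fin p)} (hS : (principal S C).PosDef) (h : B ⊆ C) :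
    (principal S B).PosDef :=
  hS.submatrix (e := fun b : {a // a ∈ B} => (⟨b.1, h b.2⟩ : {a // a ∈ C}))
    fun a b hab => Subtype.ext (by simpa using hab)

/-- These are the normal equations: the residual is uncorrelated with every regressor. -/
lemma mulVec_residual_eq_zero (hS : (principal S B).PosDef) {a : Fin p} (ha : a ∈ B) :
    (S *ᵥ equationRow i (regressionCoeff S B i)) a = 0 := by
  have h : (S *ᵥ regressionCoeff S B i) a = S a i := by
    rw [regressionCoeff, mulVec_mulVec]
    simp only [mulVec, dotProduct, mul_paddedInv_apply hS ha]
    simp [one_apply]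
  rw [equationRow, mulVec_sub, Pi.sub_apply, h]
  simp

lemma mulVec_residual_self (hi : i ∉ B) (hS : (principal S B).PosDef) :
    (S *ᵥ equationRow i (regressionCoeff S B i)) i = residualVar S B i := by
  rw [residualVar, dotProduct, Finset.sum_eq_single i]
  · rw [equationRow_apply_self (regressionCoeff_eq_zero hi), one_mul]
  · intro j _ hj
    by_cases hjB : j ∈ B
    · rw [mulVec_residual_eq_zero hS hjB, mul_zero]
    · rw [equationRow_eq_zero (fun _ => regressionCoeff_eq_zero) (B := B)
        (by simp [hj, hjB]), zero_mul]
  · simp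

lemma residualVar_pos (hi : i ∉ B) (hS : (principal S (insert i B)).PosDef) :
    0 < residualVar S B i :=
  quadForm_pos hS (fun _ => equationRow_eq_zero fun _ => regressionCoeff_eq_zero)
    (equationRow_ne_zero (regressionCoeff_eq_zero hi))

/-- Pythagoras: by the normal equations the residual is S-orthogonal to any vector supported on B,
so the cross terms vanish. -/
lemma quadForm_equationRow (hsymm : S.IsSymm) (hS : (principal S B).PosDef) {a : Fin p → ℝ}
    (ha : ∀ j, j ∉ B → a j = 0) :
    equationRow i a ⬝ᵥ (S *ᵥ equationRow i a) = residualVar S B i +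
      (a - regressionCoeff S B i) ⬝ᵥ (S *ᵥ (a - regressionCoeff S B i)) := by
  set d := a - regressionCoeff S B i with hd
  set v := equationRow i (regressionCoeff S B i) with hv
  have h0 : d ⬝ᵥ (S *ᵥ v) = 0 := by
    refine Finset.sum_eq_zero fun j _ => ?_
    by_cases hj : j ∈ B
    · rw [hv, mulVec_residual_eq_zero hS hj, mul_zero]
    · rw [hd, Pi.sub_apply, ha j hj, regressionCoeff_eq_zero hj, sub_zero, zero_mul]
  have h1 : equationRow i a = v - d := by
    rw [hv, hd, equationRow, equationRow]
    abel
  have h2 : v ⬝ᵥ (S *ᵥ d) = 0 := by rw [dotProduct_mulVec_comm_of_isSymm hsymm, h0]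
  have h3 : (v - d) ⬝ᵥ (S *ᵥ (v - d)) = v ⬝ᵥ (S *ᵥ v) + d ⬝ᵥ (S *ᵥ d) := by
    rw [mulVec_sub, dotProduct_sub, sub_dotProduct v d, sub_dotProduct v d, h0, h2]
    ring
  rw [h1, h3, residualVar]

lemma residualVar_le (hsymm : S.IsSymm) (hS : (principal S B).PosDef) {a : Fin p → ℝ}
    (ha : ∀ j, j ∉ B → a j = 0) :
    residualVar S B i ≤ equationRow i a ⬝ᵥ (S *ᵥ equationRow i a) ∧
      (equationRow i a ⬝ᵥ (S *ᵥ equationRow i a) = residualVar S B i →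
        a = regressionCoeff S B i) := by
  rw [quadForm_equationRow hsymm hS ha]
  by_cases hd : a - regressionCoeff S B i = 0
  · exact ⟨by simp [hd], fun _ => sub_eq_zero.1 hd⟩
  · have := quadForm_pos hS (v := a - regressionCoeff S B i)
      (fun j hj => by simp [ha j hj, regressionCoeff_eq_zero hj]) hd
    exact ⟨by linarith, fun h => by linarith⟩

/-- This is the Schur complement formula for a block inverse. It is verified by multiplying by S:
rows in B use the normal equations, and in row i the product of S with the residual vector is the
residual variance. -/
lemma paddedInv_insert_sub (hsymm : S.IsSymm) (hi : i ∉ B)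
    (hS : (principal S (insert i B)).PosDef) :
    paddedInv S (insert i B) - paddedInv S B = (residualVar S B i)⁻¹ •
      vecMulVec (equationRow i (regressionCoeff S B i))
        (equationRow i (regressionCoeff S B i)) := by
  have hB : (principal S B).PosDef := principal_posDef_of_subset hS (Finset.subset_insert _ _)
  have hr := (residualVar_pos hi hS).ne'
  set v := equationRow i (regressionCoeff S B i) with hv
  have hv0 : ∀ j, j ∉ insert i B → v j = 0 :=
    fun _ => equationRow_eq_zero fun _ => regressionCoeff_eq_zero
  rw [sub_eq_iff_eq_add]
  refine eq_paddedInv (fun a b hab => ?_) fun a ha b hb => ?_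
  · have h1 : paddedInv S B a b = 0 := paddedInv_eq_zero (by
      simp only [Finset.mem_insert, not_or] at hab
      tauto)
    rcases hab with h | h <;> simp [h1, vecMulVec_apply, hv0 _ h]
  · have key : (S * ((residualVar S B i)⁻¹ • vecMulVec v v + paddedInv S B)) a b =
        (residualVar S B i)⁻¹ * ((S *ᵥ v) a * v b) + (S * paddedInv S B) a b := by
      rw [mul_add, Matrix.add_apply, Matrix.mul_smul, Matrix.smul_apply, mul_vecMulVec,
        vecMulVec_apply, smul_eq_mul]
    rw [key]
    by_cases haB : a ∈ B
    · rw [hv, mulVec_residual_eq_zero hB haB, mul_paddedInv_apply hB haB]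
      simp
    · obtain rfl : a = i := by simpa [haB] using ha
      rw [hv, mulVec_residual_self hi hB, inv_mul_cancel_left₀ hr]
      have h3 : (S * paddedInv S B) a b = regressionCoeff S B a b := by
        rw [regressionCoeff, mulVec, dotProduct, mul_apply]
        refine Finset.sum_congr rfl fun c _ => ?_
        rw [mul_comm, (paddedInv_isSymm hB).apply b c, hsymm.apply c a]
      rw [h3]
      simp [equationRow, one_apply, Pi.single_apply, eq_comm]

end Regression

/-! ### Optimisation over the error variance -/

section Entropy

/-- Two inequalities are combined: monotonicity in q, and log x ≤ x - 1 at x = r/w. The latter is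
strict unless w = r, which gives the equality case. -/
lemma log_add_div_ge {r q w : ℝ} (hr : 0 < r) (hq : r ≤ q) (hw : 0 < w) :
    Real.log r + r / r ≤ Real.log w + q / w ∧
      (Real.log w + q / w = Real.log r + r / r → w = r ∧ q = r) := by
  have h1 : r / w ≤ q / w := by gcongr
  have h2 : Real.log (r / w) = Real.log r - Real.log w := Real.log_div hr.ne' hw.ne'
  have h3 := Real.log_le_sub_one_of_pos (div_pos hr hw)
  rw [div_self hr.ne']
  refine ⟨by linarith, fun h => ?_⟩
  have h4 : r / w = 1 := by
    by_contra hne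
    have := Real.log_lt_sub_one_of_pos (div_pos hr hw) hne
    linarith
  have h5 : w = r := ((div_eq_one_iff_eq hw.ne').1 h4).symm
  refine ⟨h5, ?_⟩
  rw [h4] at h2
  rw [Real.log_one] at h2
  have h6 : q / w = 1 := by linarith
  rw [div_eq_one_iff_eq hw.ne'] at h6
  linarith

end Entropy

/-! ### Structural equations: determinant, precision matrix, density -/

section Structural

variable {p : ℕ} {G : Digraph (Fin p)} {L : Matrix (Fin p) (Fin p) ℝ} {w : Fin p → ℝ}

/-- The rank counts strict ancestors. Along an edge j → i the ancestors of j are ancestors of i, and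
j itself is new by acyclicity. -/
lemma IsDAG.exists_rank (hG : IsDAG G) : ∃ r : Fin p → ℕ, ∀ i j, G.Adj j i → r j < r i := by
  classical
  refine ⟨fun i => (Finset.univ.filter fun j => Relation.TransGen G.Adj j i).card,
    fun i j hij => Finset.card_lt_card ?_⟩
  rw [Finset.ssubset_iff_of_subset]
  · exact ⟨j, by simpa using Relation.TransGen.single hij, by simpa using hG j⟩
  · intro a ha
    simp only [Finset.mem_filter, Finset.mem_univ, true_and] at ha ⊢
    exact ha.tail hij

lemma mem_pa {i j : Fin p} : j ∈ pa G i ↔ G.Adj j i := by simp [pa]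

lemma IsDAG.notMem_pa (hG : IsDAG G) (i : Fin p) : i ∉ pa G i :=
  fun h => hG i (.single (mem_pa.1 h))

/-- Sorted by rank, I - Λ is block triangular. Nodes of equal rank are not adjacent, so the diagonal
blocks are identities. -/
lemma IsDAG.det_one_sub (hG : IsDAG G) (hL : ∀ i j, ¬ G.Adj j i → L i j = 0) :
    (1 - L).det = 1 := by
  obtain ⟨r, hr⟩ := hG.exists_rank
  have hz : ∀ i j, r i ≤ r j → L i j = 0 := fun i j h =>
    hL i j fun hadj => absurd (hr i j hadj) (by omega)
  have htri : (1 - L).BlockTriangular (fun i => OrderDual.toDual (r i)) := by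
    intro i j hij
    rw [OrderDual.toDual_lt_toDual] at hij
    have hne : i ≠ j := by rintro rfl; omega
    simp [hne, hz i j hij.le]
  rw [htri.det]
  refine Finset.prod_eq_one fun a _ => ?_
  have : (1 - L).toSquareBlock (fun i => OrderDual.toDual (r i)) a = 1 := by
    ext x y
    have hxy : r x.1 = r y.1 := OrderDual.toDual.injective (x.2.trans y.2.symm)
    simp [toSquareBlock_def, hz x y hxy.le, one_apply, Subtype.coe_inj]
  rw [this, det_one]

lemma structuralCov_det (hG : IsDAG G) (h : IsParam G L w) :
    (structuralCov L w).det = ∏ i, w i := by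
  rw [structuralCov, det_mul, det_mul, det_transpose, det_diagonal, det_nonsing_inv,
    hG.det_one_sub h.1]
  simp

lemma transpose_mul_diagonal_mul :
    (1 - L)ᵀ * diagonal (fun i => (w i)⁻¹) * (1 - L) =
      ∑ i, (w i)⁻¹ • vecMulVec (equationRow i (L i)) (equationRow i (L i)) := by
  ext a b
  rw [mul_apply, Matrix.sum_apply]
  refine Finset.sum_congr rfl fun i _ => ?_
  rw [mul_diagonal]
  simp only [transpose_apply, Matrix.sub_apply, Matrix.smul_apply, vecMulVec_apply, equationRow,
    Pi.sub_apply, smul_eq_mul, one_apply, Pi.single_apply]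
  simp only [eq_comm (a := i)]
  ring

lemma structuralCov_mul (hG : IsDAG G) (h : IsParam G L w) :
    structuralCov L w * ((1 - L)ᵀ * diagonal (fun i => (w i)⁻¹) * (1 - L)) = 1 := by
  have hu : IsUnit (1 - L).det := by rw [hG.det_one_sub h.1]; exact isUnit_one
  have h1 : ((1 - L)⁻¹)ᵀ * (1 - L)ᵀ = 1 := by
    rw [← transpose_mul, mul_nonsing_inv _ hu, transpose_one]
  have h2 : diagonal w * diagonal (fun i => (w i)⁻¹) = 1 := by
    rw [diagonal_mul_diagonal, ← diagonal_one]
    congr 1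
    ext i
    exact mul_inv_cancel₀ (h.2 i).ne'
  calc _ = (1 - L)⁻¹ * (diagonal w * (((1 - L)⁻¹)ᵀ * (1 - L)ᵀ) *
        diagonal (fun i => (w i)⁻¹)) * (1 - L) := by
          simp only [structuralCov, Matrix.mul_assoc]
    _ = 1 := by rw [h1, Matrix.mul_one, h2, Matrix.mul_one, nonsing_inv_mul _ hu]

lemma structuralCov_inv (hG : IsDAG G) (h : IsParam G L w) :
    (structuralCov L w)⁻¹ =
      ∑ i, (w i)⁻¹ • vecMulVec (equationRow i (L i)) (equationRow i (L i)) := by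
  rw [← transpose_mul_diagonal_mul]
  exact inv_eq_right_inv (structuralCov_mul hG h)

lemma structuralCov_posDef (hG : IsDAG G) (h : IsParam G L w) : (structuralCov L w).PosDef := by
  have hu : IsUnit (1 - L).det := by rw [hG.det_one_sub h.1]; exact isUnit_one
  have hd : (diagonal w).PosDef := posDef_diagonal_iff.2 h.2
  have := hd.mul_mul_conjTranspose_same (B := (1 - L)⁻¹)
    (vecMul_injective_of_isUnit (by rw [isUnit_nonsing_inv_iff, isUnit_iff_isUnit_det]; exact hu))
  rwa [conjTranspose_eq_transpose_of_trivial] at this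

lemma gaussianDensity_structuralCov (hG : IsDAG G) (h : IsParam G L w)
    (x : EuclideanSpace ℝ (Fin p)) :
    0 < gaussianDensity (structuralCov L w) x ∧
    Real.log (gaussianDensity (structuralCov L w) x) = -(1 / 2) *
      (p * Real.log (2 * Real.pi) +
        ∑ i, (Real.log (w i) + (equationRow i (L i) ⬝ᵥ x.ofLp) ^ 2 / w i)) := by
  have hdet := structuralCov_det hG h
  have hw : 0 < ∏ i, w i := Finset.prod_pos fun i _ => h.2 i
  have hc : 0 < (2 * Real.pi) ^ p * (structuralCov L w).det := by rw [hdet]; positivity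
  have hq : x.ofLp ⬝ᵥ ((structuralCov L w)⁻¹ *ᵥ x.ofLp) =
      ∑ i, (equationRow i (L i) ⬝ᵥ x.ofLp) ^ 2 / w i := by
    rw [structuralCov_inv hG h, sum_mulVec, dotProduct_sum]
    refine Finset.sum_congr rfl fun i _ => ?_
    rw [smul_mulVec, dotProduct_smul, vecMulVec_mulVec, dotProduct_smul,
      dotProduct_comm x.ofLp (equationRow _ _)]
    simp only [MulOpposite.smul_eq_mul_unop, MulOpposite.unop_op, smul_eq_mul]
    ring
  have hs : 0 < (Real.sqrt ((2 * Real.pi) ^ p * (structuralCov L w).det))⁻¹ :=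
    inv_pos.2 (Real.sqrt_pos.2 hc)
  refine ⟨mul_pos hs (Real.exp_pos _), ?_⟩
  rw [gaussianDensity, Real.log_mul hs.ne' (Real.exp_pos _).ne', Real.log_exp, Real.log_inv,
    Real.log_sqrt hc.le, hq, hdet, Real.log_mul (by positivity) hw.ne', Real.log_pow,
    Real.log_prod (fun i _ => (h.2 i).ne'), Finset.sum_add_distrib]
  ring

end Structural

/-! ### Decomposition of the log-likelihood over nodes and experiments -/

section Likelihood

variable {p K : ℕ} {G : Digraph (Fin p)} {I : Fin (K + 1) → Finset (Fin p)} {n : Fin (K + 1) → ℕ}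
  {L L' : Fin (K + 1) → Matrix (Fin p) (Fin p) ℝ} {w w' : Fin (K + 1) → Fin p → ℝ}

/-- The contribution of the structural equation of node `i` in experiment `k`, with coefficients
`a` and error variance `v`, to minus twice the log-likelihood. -/
noncomputable def equationLoss (D : Data p n) (k : Fin (K + 1)) (i : Fin p) (a : Fin p → ℝ)
    (v : ℝ) : ℝ :=
  n k * Real.log v + (∑ j, (equationRow i a ⬝ᵥ (D k j).ofLp) ^ 2) / v

lemma likelihood_structuralCov (hG : IsDAG G) (h : ∀ k, IsParam G (L k) (w k)) (D : Data p n) :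
    0 < likelihood D (fun k => structuralCov (L k) (w k)) ∧
    Real.log (likelihood D (fun k => structuralCov (L k) (w k))) = -(1 / 2) *
      (∑ k, n k * (p * Real.log (2 * Real.pi)) +
        ∑ k, ∑ i, equationLoss D k i (L k i) (w k i)) := by
  have hpos := fun k j => (gaussianDensity_structuralCov hG (h k) (D k j)).1
  refine ⟨Finset.prod_pos fun k _ => Finset.prod_pos fun j _ => hpos k j, ?_⟩
  rw [likelihood, Real.log_prod fun k _ => (Finset.prod_pos fun j _ => hpos k j).ne',
    ← Finset.sum_add_distrib, Finset.mul_sum]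
  refine Finset.sum_congr rfl fun k _ => ?_
  rw [Real.log_prod fun j _ => (hpos k j).ne']
  simp only [(gaussianDensity_structuralCov hG (h k) _).2, equationLoss, ← Finset.mul_sum,
    Finset.sum_add_distrib, Finset.sum_const, Finset.card_univ, Fintype.card_fin, nsmul_eq_mul,
    Finset.sum_div]
  rw [Finset.sum_comm]
  ring

lemma likelihood_le_iff (hG : IsDAG G) (h : ∀ k, IsParam G (L k) (w k))
    (h' : ∀ k, IsParam G (L' k) (w' k)) (D : Data p n) :
    likelihood D (fun k => structuralCov (L k) (w k)) ≤
      likelihood D (fun k => structuralCov (L' k) (w' k)) ↔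
    ∑ k, ∑ i, equationLoss D k i (L' k i) (w' k i) ≤
      ∑ k, ∑ i, equationLoss D k i (L k i) (w k i) := by
  obtain ⟨h1, h2⟩ := likelihood_structuralCov hG h D
  obtain ⟨h3, h4⟩ := likelihood_structuralCov hG h' D
  rw [← Real.log_le_log_iff h1 h3, h2, h4]
  constructor <;> intro h <;> linarith

lemma pooledCov_isSymm (D : Data p n) (A : Finset (Fin (K + 1))) : (pooledCov D A).IsSymm := by
  refine IsSymm.ext fun a b => ?_
  simp only [pooledCov, Matrix.smul_apply, Matrix.sum_apply, vecMulVec_apply]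
  simp only [mul_comm]

lemma quadForm_pooledCov (D : Data p n) (A : Finset (Fin (K + 1))) (v : Fin p → ℝ) :
    v ⬝ᵥ (pooledCov D A *ᵥ v) =
      (∑ k ∈ A, (n k : ℝ))⁻¹ * ∑ k ∈ A, ∑ j, (v ⬝ᵥ (D k j).ofLp) ^ 2 := by
  rw [pooledCov, smul_mulVec, dotProduct_smul, smul_eq_mul, sum_mulVec, dotProduct_sum]
  congr 1
  refine Finset.sum_congr rfl fun k _ => ?_
  rw [sum_mulVec, dotProduct_sum]
  refine Finset.sum_congr rfl fun j _ => ?_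
  rw [vecMulVec_mulVec, dotProduct_smul, dotProduct_comm _ v]
  simp only [MulOpposite.smul_eq_mul_unop, MulOpposite.unop_op]
  ring

lemma sum_equationLoss (D : Data p n) {A : Finset (Fin (K + 1))}
    (hA : 0 < ∑ k ∈ A, (n k : ℝ)) (i : Fin p) (a : Fin p → ℝ) (v : ℝ) :
    ∑ k ∈ A, equationLoss D k i a v = (∑ k ∈ A, (n k : ℝ)) *
      (Real.log v + (equationRow i a ⬝ᵥ (pooledCov D A *ᵥ equationRow i a)) / v) := by
  rw [quadForm_pooledCov]
  simp only [equationLoss, Finset.sum_add_distrib, ← Finset.sum_mul, ← Finset.sum_div]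
  field_simp

end Likelihood

/-! ### Explicit minimiser and uniqueness under positive definiteness -/

section MLE

variable {p K : ℕ} {G : Digraph (Fin p)} {I : Fin (K + 1) → Finset (Fin p)} {n : Fin (K + 1) → ℕ}
  {L : Fin (K + 1) → Matrix (Fin p) (Fin p) ℝ} {w : Fin (K + 1) → Fin p → ℝ} {D : Data p n}

/-- The experiments that share the structural equation of node `i` with experiment `k`. -/
def block (I : Fin (K + 1) → Finset (Fin p)) (k : Fin (K + 1)) (i : Fin p) :
    Finset (Fin (K + 1)) :=
  if i ∈ I k then {k} else nonTargeting I i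

/-- Admissible parameters of the interventional model. -/
def IsModelParam (G : Digraph (Fin p)) (I : Fin (K + 1) → Finset (Fin p))
    (L : Fin (K + 1) → Matrix (Fin p) (Fin p) ℝ) (w : Fin (K + 1) → Fin p → ℝ) : Prop :=
  (∀ k, IsParam G (L k) (w k)) ∧
    ∀ k, ∀ i, i ∉ I k → (∀ j, L k i j = L 0 i j) ∧ w k i = w 0 i

lemma mem_model_iff {S : Fin (K + 1) → Matrix (Fin p) (Fin p) ℝ} :
    S ∈ model G I ↔ ∃ L w, IsModelParam G I L w ∧ S = fun k => structuralCov (L k) (w k) := by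
  constructor
  · rintro ⟨L, w, h1, h2, h3⟩
    exact ⟨L, w, ⟨h1, h2⟩, funext h3⟩
  · rintro ⟨L, w, ⟨h1, h2⟩, rfl⟩
    exact ⟨L, w, h1, h2, fun _ => rfl⟩

lemma isMLE_structuralCov_iff (hG : IsDAG G) (h : IsModelParam G I L w) :
    IsMLE G I D (fun k => structuralCov (L k) (w k)) ↔ ∀ L' w', IsModelParam G I L' w' →
      ∑ k, ∑ i, equationLoss D k i (L k i) (w k i) ≤
        ∑ k, ∑ i, equationLoss D k i (L' k i) (w' k i) := by
  constructor
  · rintro ⟨-, h2⟩ L' w' h'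
    exact (likelihood_le_iff hG h'.1 h.1 D).1 (h2 (mem_model_iff.2 ⟨L', w', h', rfl⟩))
  · refine fun h2 => ⟨mem_model_iff.2 ⟨L, w, h, rfl⟩, fun S hS => ?_⟩
    obtain ⟨L', w', h', rfl⟩ := mem_model_iff.1 hS
    exact (likelihood_le_iff hG h'.1 h.1 D).2 (h2 L' w' h')

lemma self_mem_block (k : Fin (K + 1)) (i : Fin p) : k ∈ block I k i := by
  unfold block
  split_ifs with h
  · simp
  · simp [nonTargeting, h]

/-- For fixed i the blocks partition the experiments. -/
lemma block_eq_of_mem {k l : Fin (K + 1)} {i : Fin p} (h : l ∈ block I k i) :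
    block I l i = block I k i := by
  unfold block at h ⊢
  split_ifs at h with hk
  · rw [Finset.mem_singleton] at h
    rw [h]
  · rw [if_neg hk, if_neg (by simpa [nonTargeting] using h)]

lemma block_pos (hn : ∀ k, 0 < n k) (k : Fin (K + 1)) (i : Fin p) :
    0 < ∑ l ∈ block I k i, (n l : ℝ) :=
  Finset.sum_pos (fun l _ => by exact_mod_cast hn l) ⟨k, self_mem_block k i⟩

lemma familyPosDef_iff : FamilyPosDef G I D ↔
    ∀ k i, (principal (pooledCov D (block I k i)) (fa G i)).PosDef := by
  constructor
  · intro h k i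
    unfold block
    split_ifs with hi
    · exact (h k).1 i hi
    · exact (h k).2 i hi
  · intro h k
    exact ⟨fun i hi => by simpa [block, hi] using h k i,
      fun i hi => by simpa [block, hi] using h k i⟩

lemma sampleSize_iff : (∀ k, (∀ i ∈ I k, (fa G i).card ≤ n k) ∧
      ∀ i, i ∉ I k → (fa G i).card ≤ ∑ l ∈ nonTargeting I i, n l) ↔
    ∀ k i, (fa G i).card ≤ ∑ l ∈ block I k i, n l := by
  constructor
  · intro h k i
    unfold block
    split_ifs with hi
    · simpa using (h k).1 i hi
    · exact (h k).2 i hi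
  · intro h k
    exact ⟨fun i hi => by simpa [block, hi] using h k i,
      fun i hi => by simpa [block, hi] using h k i⟩

/-- The estimated coefficients of the structural equations. -/
noncomputable def coeffHat (G : Digraph (Fin p)) (I : Fin (K + 1) → Finset (Fin p))
    (D : Data p n) (k : Fin (K + 1)) : Matrix (Fin p) (Fin p) ℝ :=
  fun i => regressionCoeff (pooledCov D (block I k i)) (pa G i) i

/-- The estimated error variances. -/
noncomputable def varHat (G : Digraph (Fin p)) (I : Fin (K + 1) → Finset (Fin p))
    (D : Data p n) (k : Fin (K + 1)) : Fin p → ℝ :=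
  fun i => residualVar (pooledCov D (block I k i)) (pa G i) i

lemma isModelParam_hat (hG : IsDAG G) (hI : I 0 = ∅) (hD : FamilyPosDef G I D) :
    IsModelParam G I (coeffHat G I D) (varHat G I D) := by
  rw [familyPosDef_iff] at hD
  refine ⟨fun k => ⟨fun i j hij => regressionCoeff_eq_zero (by rwa [mem_pa]),
    fun i => residualVar_pos (hG.notMem_pa i) (hD k i)⟩, fun k i hi => ?_⟩
  have h0 : block I k i = block I 0 i := by simp [block, hi, hI]
  exact ⟨fun j => by simp only [coeffHat, h0], by simp only [varHat, h0]⟩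

lemma precisionHat_eq (hG : IsDAG G) (hI : I 0 = ∅) (hD : FamilyPosDef G I D)
    (k : Fin (K + 1)) :
    precisionHat G I D k = (structuralCov (coeffHat G I D k) (varHat G I D k))⁻¹ := by
  rw [structuralCov_inv hG ((isModelParam_hat hG hI hD).1 k), precisionHat,
    ← Finset.sum_compl_add_sum (I k)]
  rw [familyPosDef_iff] at hD
  have key : ∀ i, (varHat G I D k i)⁻¹ • vecMulVec (equationRow i (coeffHat G I D k i))
      (equationRow i (coeffHat G I D k i)) =
      paddedInv (pooledCov D (block I k i)) (fa G i) -
        paddedInv (pooledCov D (block I k i)) (pa G i) :=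
    fun i => (paddedInv_insert_sub (pooledCov_isSymm _ _) (hG.notMem_pa i) (hD k i)).symm
  simp only [key]
  congr 1
  · refine Finset.sum_congr rfl fun i hi => ?_
    rw [block, if_neg (by simpa using hi)]
  · refine Finset.sum_congr rfl fun i hi => ?_
    rw [block, if_pos hi]

lemma sum_block_equationLoss_le {A : Finset (Fin (K + 1))} (hA : 0 < ∑ k ∈ A, (n k : ℝ))
    {B : Finset (Fin p)} {i : Fin p} (hi : i ∉ B)
    (hD : (principal (pooledCov D A) (insert i B)).PosDef) {a : Fin p → ℝ} {v : ℝ}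
    (ha : ∀ j, j ∉ B → a j = 0) (hv : 0 < v) :
    ∑ k ∈ A, equationLoss D k i (regressionCoeff (pooledCov D A) B i)
        (residualVar (pooledCov D A) B i) ≤ ∑ k ∈ A, equationLoss D k i a v ∧
    (∑ k ∈ A, equationLoss D k i a v = ∑ k ∈ A, equationLoss D k i
        (regressionCoeff (pooledCov D A) B i) (residualVar (pooledCov D A) B i) →
      a = regressionCoeff (pooledCov D A) B i ∧ v = residualVar (pooledCov D A) B i) := by
  rw [sum_equationLoss D hA, sum_equationLoss D hA]
  obtain ⟨h1, h2⟩ := residualVar_le (i := i) (pooledCov_isSymm D A)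
    (principal_posDef_of_subset hD (Finset.subset_insert _ _)) ha
  obtain ⟨h3, h4⟩ := log_add_div_ge (residualVar_pos hi hD) h1 hv
  refine ⟨mul_le_mul_of_nonneg_left h3 hA.le, fun h => ?_⟩
  obtain ⟨h5, h6⟩ := h4 (mul_left_cancel₀ hA.ne' h)
  exact ⟨h2 h6, h5⟩

/-- Experiments not targeting i share one parameter, represented by experiment 0 because `I 0 = ∅`;
each targeting experiment is optimised alone. Equality of the totals forces equality on every block,
hence uniqueness. -/
lemma sum_equationLoss_hat_le (hG : IsDAG G) (hI : I 0 = ∅) (hn : ∀ k, 0 < n k)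
    (hD : FamilyPosDef G I D) (h : IsModelParam G I L w) (i : Fin p) :
    ∑ k, equationLoss D k i (coeffHat G I D k i) (varHat G I D k i) ≤
        ∑ k, equationLoss D k i (L k i) (w k i) ∧
    (∑ k, equationLoss D k i (L k i) (w k i) =
        ∑ k, equationLoss D k i (coeffHat G I D k i) (varHat G I D k i) →
      ∀ k, L k i = coeffHat G I D k i ∧ w k i = varHat G I D k i) := by
  rw [familyPosDef_iff] at hD
  have hopt := fun k => sum_block_equationLoss_le (block_pos hn k i) (hG.notMem_pa i) (hD k i)
    (a := L k i) (v := w k i) (fun j hj => (h.1 k).1 i j (by rwa [mem_pa] at hj)) ((h.1 k).2 i)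
  have hsplit : ∀ f : Fin (K + 1) → ℝ, ∑ k, f k = ∑ k ∈ nonTargeting I i, f k +
      ∑ k ∈ (nonTargeting I i)ᶜ, f k := fun f => (Finset.sum_add_sum_compl _ f).symm
  have hnon : ∀ k ∈ nonTargeting I i, i ∉ I k := fun k hk => by simpa [nonTargeting] using hk
  have htar : ∀ k ∈ (nonTargeting I i)ᶜ, i ∈ I k := fun k hk => by
    simpa [nonTargeting] using hk
  have hb0 : block I 0 i = nonTargeting I i := by simp [block, hI]
  have hbnon : ∀ k ∈ nonTargeting I i, block I k i = block I 0 i := fun k hk => by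
    rw [hb0, block, if_neg (hnon k hk)]
  have hbtar : ∀ k ∈ (nonTargeting I i)ᶜ, block I k i = {k} := fun k hk => by
    rw [block, if_pos (htar k hk)]
  have h0 := hopt 0
  have e1 : ∑ k ∈ nonTargeting I i, equationLoss D k i (L k i) (w k i) =
      ∑ k ∈ block I 0 i, equationLoss D k i (L 0 i) (w 0 i) := by
    rw [hb0]
    refine Finset.sum_congr rfl fun k hk => ?_
    obtain ⟨h1, h2⟩ := h.2 k i (hnon k hk)
    rw [h2, show L k i = L 0 i from funext h1]
  have e2 : ∑ k ∈ nonTargeting I i,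
        equationLoss D k i (coeffHat G I D k i) (varHat G I D k i) =
      ∑ k ∈ block I 0 i, equationLoss D k i (coeffHat G I D 0 i) (varHat G I D 0 i) := by
    conv_rhs => rw [hb0]
    refine Finset.sum_congr rfl fun k hk => ?_
    simp only [coeffHat, varHat, hbnon k hk]
  have h3 : ∀ k ∈ (nonTargeting I i)ᶜ,
      equationLoss D k i (coeffHat G I D k i) (varHat G I D k i) ≤
        equationLoss D k i (L k i) (w k i) := fun k hk => by
    have := (hopt k).1
    simp only [hbtar k hk, Finset.sum_singleton] at this
    simpa only [coeffHat, varHat, hbtar k hk] using this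
  have h4 := Finset.sum_le_sum h3
  have h01 := h0.1
  change ∑ k ∈ block I 0 i, equationLoss D k i (coeffHat G I D 0 i) (varHat G I D 0 i) ≤ _ at h01
  rw [hsplit, hsplit, e1, e2]
  refine ⟨add_le_add h01 h4, fun heq k => ?_⟩
  by_cases hk : k ∈ nonTargeting I i
  · obtain ⟨h5, h6⟩ := h.2 k i (hnon k hk)
    have := h0.2 (by
      change _ = ∑ k ∈ block I 0 i, equationLoss D k i (coeffHat G I D 0 i) (varHat G I D 0 i)
      linarith)
    rw [h6, show L k i = L 0 i from funext h5]
    simpa only [coeffHat, varHat, hbnon k hk] using this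
  · have hk' : k ∈ (nonTargeting I i)ᶜ := by simpa using hk
    have h5 := (Finset.sum_eq_sum_iff_of_le h3).1 (by linarith) k hk'
    have := (hopt k).2
    simp only [hbtar k hk', Finset.sum_singleton] at this
    simp only [coeffHat, varHat, hbtar k hk'] at h5 ⊢
    exact this h5.symm

theorem posDef_precisionHat (hG : IsDAG G) (hI : I 0 = ∅) (hD : FamilyPosDef G I D)
    (k : Fin (K + 1)) : (precisionHat G I D k).PosDef := by
  rw [precisionHat_eq hG hI hD]
  exact (structuralCov_posDef hG ((isModelParam_hat hG hI hD).1 k)).inv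

theorem isMLE_iff_of_familyPosDef (hG : IsDAG G) (hI : I 0 = ∅) (hn : ∀ k, 0 < n k)
    (hD : FamilyPosDef G I D) (S : Fin (K + 1) → Matrix (Fin p) (Fin p) ℝ) :
    IsMLE G I D S ↔ ∀ k, S k = (precisionHat G I D k)⁻¹ := by
  have hhat := isModelParam_hat hG hI hD
  have hinv : ∀ k, (precisionHat G I D k)⁻¹ =
      structuralCov (coeffHat G I D k) (varHat G I D k) := fun k => by
    rw [precisionHat_eq hG hI hD, nonsing_inv_nonsing_inv]
    exact (isUnit_iff_isUnit_det _).1 (structuralCov_posDef hG (hhat.1 k)).isUnit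
  simp only [hinv]
  constructor
  · intro hS k
    obtain ⟨L, w, h, rfl⟩ := mem_model_iff.1 hS.1
    have h1 := (isMLE_structuralCov_iff hG h).1 hS _ _ hhat
    rw [Finset.sum_comm, Finset.sum_comm (s := Finset.univ) (t := Finset.univ)
      (f := fun k i => equationLoss D k i (coeffHat G I D k i) (varHat G I D k i))] at h1
    have h2 := fun i => sum_equationLoss_hat_le hG hI hn hD h i
    -- The estimate is optimal at each node separately, so equal total losses are equal node by
    -- node.
    have h3 := (Finset.sum_eq_sum_iff_of_le fun i _ => (h2 i).1).1
      (le_antisymm (Finset.sum_le_sum fun i _ => (h2 i).1) h1)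
    have h4 := fun i => (h2 i).2 (h3 i (Finset.mem_univ i)).symm k
    have h5 : L k = coeffHat G I D k := funext fun i => (h4 i).1
    have h6 : w k = varHat G I D k := funext fun i => (h4 i).2
    simp only [h5, h6]
  · intro hS
    rw [show S = fun k => structuralCov (coeffHat G I D k) (varHat G I D k) from funext hS,
      isMLE_structuralCov_iff hG hhat]
    intro L w h
    rw [Finset.sum_comm, Finset.sum_comm (s := Finset.univ) (t := Finset.univ)
      (f := fun k i => equationLoss D k i (L k i) (w k i))]
    exact Finset.sum_le_sum fun i _ => (sum_equationLoss_hat_le hG hI hn hD h i).1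

end MLE

/-! ### Almost sure linear independence of random vectors -/

section Genericity

variable {Ω ι E : Type*} [MeasurableSpace Ω] {P : Measure Ω} [NormedAddCommGroup E]
  [NormedSpace ℝ E] [FiniteDimensional ℝ E] [MeasurableSpace E] [BorelSpace E]

/-- By Fubini it suffices to fix an independent family: a bad new vector lies in its span, which is
proper by the dimension count. Measurability comes from openness of linear independence. -/
lemma ae_linearIndependent_casesOn {κ : Type*} [Finite κ] (hκ : Nat.card κ < Module.finrank ℝ E)
    {μ : Measure E} {ν : Measure (κ → E)} [SFinite μ] [SFinite ν]
    (hμ : ∀ W : Submodule ℝ E, W ≠ ⊤ → μ W = 0) :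
    ∀ᵐ z ∂(ν.prod μ), LinearIndependent ℝ z.1 →
      LinearIndependent ℝ (fun o => Option.casesOn' o z.2 z.1 : Option κ → E) := by
  have := FiniteDimensional.proper_real E
  have hcont : Continuous fun z : (κ → E) × E =>
      (fun o => Option.casesOn' o z.2 z.1 : Option κ → E) := by
    refine continuous_pi fun o => ?_
    cases o with
    | none => exact continuous_snd
    | some t => exact (continuous_apply t).comp continuous_fst
  have h1 : MeasurableSet {z : (κ → E) × E | LinearIndependent ℝ z.1} :=
    (isOpen_setOfPred_linearIndependent.preimage continuous_fst).measurableSet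
  have h2 : MeasurableSet {z : (κ → E) × E | LinearIndependent ℝ
      (fun o => Option.casesOn' o z.2 z.1 : Option κ → E)} :=
    (isOpen_setOfPred_linearIndependent.preimage hcont).measurableSet
  have hs : {z : (κ → E) × E | ¬ (LinearIndependent ℝ z.1 → LinearIndependent ℝ
      (fun o => Option.casesOn' o z.2 z.1 : Option κ → E))} =
      {z | LinearIndependent ℝ z.1} \ {z | LinearIndependent ℝ
      (fun o => Option.casesOn' o z.2 z.1 : Option κ → E)} := by
    ext z
    simp
  rw [ae_iff, hs, Measure.measure_prod_null (h1.diff h2)]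
  refine Filter.Eventually.of_forall fun y => ?_
  refine measure_mono_null (t := (Submodule.span ℝ (Set.range y) : Set E)) ?_ (hμ _ fun htop => ?_)
  · rintro x ⟨hy, hx⟩
    by_contra hxs
    exact hx (linearIndependent_option'.2 ⟨hy, hxs⟩)
  · have := Fintype.ofFinite κ
    have h3 := finrank_range_le_card (R := ℝ) y
    rw [Set.finrank, htop, finrank_top, ← Nat.card_eq_fintype_card] at h3
    omega

/-- Independent random vectors whose laws do not charge proper subspaces are almost surely
linearly independent, as long as there are no more of them than the dimension. -/
lemma ae_linearIndepOn [IsProbabilityMeasure P] {X : ι → Ω → E} (hX : ∀ i, AEMeasurable (X i) P)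
    (hind : iIndepFun X P)
    (hnull : ∀ i, ∀ W : Submodule ℝ E, W ≠ ⊤ → P.map (X i) W = 0)
    (T : Finset ι) (hT : T.card ≤ Module.finrank ℝ E) :
    ∀ᵐ ω ∂P, LinearIndepOn ℝ (fun i => X i ω) (T : Set ι) := by
  classical
  induction T using Finset.induction_on with
  | empty => simp
  | insert q T hq ih =>
    rw [Finset.card_insert_of_notMem hq] at hT
    have hY : AEMeasurable (fun ω (t : T) => X t ω) P := aemeasurable_pi_lambda _ fun t => hX t
    -- Independence makes the joint law of the old vectors and the new one a product measure.
    have hindep : IndepFun (fun ω (t : T) => X t ω) (X q) P :=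
      (hind.indepFun_finset₀ T {q} (by simpa using hq) hX).comp (φ := id)
        (ψ := fun z : (({q} : Finset ι) → E) => z ⟨q, by simp⟩) measurable_id
        (measurable_pi_apply _)
    have hmap := hindep.map_prod_eq_prod_map_map hY (hX q)
    have key := ae_linearIndependent_casesOn (κ := T) (μ := P.map (X q))
      (ν := P.map fun ω (t : T) => X t ω) (by simpa using by omega) (hnull q)
    rw [← hmap] at key
    filter_upwards [ae_of_ae_map (hY.prodMk (hX q)) key, ih (by omega)] with ω h1 h2
    have h3 := (linearIndependent_option'.1 (h1 h2)).2
    rw [Finset.coe_insert, linearIndepOn_insert (by simpa using hq)]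
    refine ⟨h2, ?_⟩
    rwa [Set.image_eq_range]

lemma exists_dotProduct_eq_zero_of_ne_top {κ : Type*} [Fintype κ] {W : Submodule ℝ (κ → ℝ)}
    (hW : W ≠ ⊤) : ∃ c : κ → ℝ, c ≠ 0 ∧ ∀ x ∈ W, c ⬝ᵥ x = 0 := by
  classical
  obtain ⟨f, hf, hWf⟩ := W.exists_le_ker_of_lt_top hW.lt_top
  have hc : ∀ x, (fun b => f (Pi.single b 1)) ⬝ᵥ x = f x := fun x => by
    conv_rhs => rw [← Finset.univ_sum_single x, map_sum]
    refine Finset.sum_congr rfl fun b _ => ?_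
    rw [show Pi.single b (x b) = x b • Pi.single b (1 : ℝ) by
      rw [← Pi.single_smul]; simp, map_smul, smul_eq_mul, mul_comm]
  refine ⟨_, fun h => hf (LinearMap.ext fun x => ?_), fun x hx => (hc x).trans (hWf hx)⟩
  rw [← hc, h]
  simp

/-- The functional x ↦ c·x has a real Gaussian law of variance cᵀSc > 0, which has no atoms. -/
lemma multivariateGaussian_hyperplane {p : ℕ} {S : Matrix (Fin p) (Fin p) ℝ} (hS : S.PosDef)
    {c : Fin p → ℝ} (hc : c ≠ 0) :
    multivariateGaussian 0 S {x | c ⬝ᵥ x.ofLp = 0} = 0 := by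
  set μ := multivariateGaussian (0 : EuclideanSpace ℝ (Fin p)) S
  set l : StrongDual ℝ (EuclideanSpace ℝ (Fin p)) := innerSL ℝ (WithLp.toLp 2 c) with hl
  have hlx : ∀ x, l x = c ⬝ᵥ x.ofLp := fun x => by
    rw [hl, innerSL_apply_apply, EuclideanSpace.inner_eq_star_dotProduct, dotProduct_comm]
    simp
  have hvar : Var[l; μ] = c ⬝ᵥ (S *ᵥ c) := by
    have h1 := covarianceBilin_multivariateGaussian (μ := 0) hS.posSemidef
      (WithLp.toLp 2 c) (WithLp.toLp 2 c)
    rw [covarianceBilin_self IsGaussian.memLp_two_id] at h1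
    exact h1
  have hpos : 0 < Var[l; μ] := hvar ▸ hS.dotProduct_mulVec_pos hc
  have hset : {x : EuclideanSpace ℝ (Fin p) | c ⬝ᵥ x.ofLp = 0} = l ⁻¹' {0} := by
    ext x
    simp [hlx]
  have := nullSingletonClass_gaussianReal (μ := μ[l]) (v := (Var[l; μ]).toNNReal)
    (by simpa using hpos)
  rw [hset, ← Measure.map_apply l.continuous.measurable (measurableSet_singleton _),
    IsGaussian.map_eq_gaussianReal l, measure_singleton]

end Genericity

/-! ### General position of the data and existence of the MLE -/

section Data

variable {p K : ℕ} {G : Digraph (Fin p)} {I : Fin (K + 1) → Finset (Fin p)} {n : Fin (K + 1) → ℕ}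
  {D : Data p n} {A : Finset (Fin (K + 1))} {B : Finset (Fin p)}

/-- The coordinates in `B` of the observation `q.2` of experiment `q.1`. -/
def restrictedObs (D : Data p n) (B : Finset (Fin p)) (q : (k : Fin (K + 1)) × Fin (n k)) :
    {b // b ∈ B} → ℝ :=
  fun b => D q.1 q.2 b

/-- Any at most `|B|` observations have linearly independent restrictions to `B`. -/
def InGeneralPosition (D : Data p n) (B : Finset (Fin p)) : Prop :=
  ∀ T : Finset ((k : Fin (K + 1)) × Fin (n k)), T.card ≤ B.card →
    LinearIndepOn ℝ (restrictedObs D B) (T : Set ((k : Fin (K + 1)) × Fin (n k)))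

/-- The indices of the observations in the experiments in `A`. -/
def obsIndex (n : Fin (K + 1) → ℕ) (A : Finset (Fin (K + 1))) :
    Finset ((k : Fin (K + 1)) × Fin (n k)) :=
  A.sigma fun _ => Finset.univ

lemma card_obsIndex : (obsIndex n A).card = ∑ k ∈ A, n k := by
  simp [obsIndex, Finset.card_sigma]

lemma dotProduct_restrictedObs {v : Fin p → ℝ} (hv : ∀ j, j ∉ B → v j = 0)
    (q : (k : Fin (K + 1)) × Fin (n k)) :
    (fun b : {b // b ∈ B} => v b) ⬝ᵥ restrictedObs D B q = v ⬝ᵥ (D q.1 q.2).ofLp :=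
  sum_coe_eq_sum_of_support (f := fun j => v j * D q.1 q.2 j) fun j hj => by simp [hv j hj]

lemma quadForm_pooledCov_pos (hA : 0 < ∑ k ∈ A, (n k : ℝ)) {v : Fin p → ℝ} :
    0 < v ⬝ᵥ (pooledCov D A *ᵥ v) ↔ ∃ q ∈ obsIndex n A, v ⬝ᵥ (D q.1 q.2).ofLp ≠ 0 := by
  rw [quadForm_pooledCov, mul_pos_iff_of_pos_left (inv_pos.2 hA), Finset.sum_sigma']
  change 0 < ∑ q ∈ obsIndex n A, (v ⬝ᵥ (D q.1 q.2).ofLp) ^ 2 ↔ _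
  rw [Finset.sum_pos_iff_of_nonneg fun _ _ => sq_nonneg _]
  simp only [sq_pos_iff]

/-- Some |B| of the observations restrict to a spanning family, so no nonzero vector supported on B
is orthogonal to all of them. -/
lemma posDef_of_inGeneralPosition (hA : 0 < ∑ k ∈ A, (n k : ℝ)) (hD : InGeneralPosition D B)
    (hB : B.card ≤ ∑ k ∈ A, n k) : (principal (pooledCov D A) B).PosDef := by
  refine posDef_principal_of_quadForm_pos (pooledCov_isSymm _ _) fun v hv hv0 => ?_
  rw [quadForm_pooledCov_pos hA]
  by_contra! hcon
  obtain ⟨T, hTA, hT⟩ := Finset.exists_subset_card_eq (card_obsIndex (n := n) ▸ hB)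
  have hli := hD T hT.le
  have hspan := LinearIndependent.span_eq_top_of_card_eq_finrank' hli (by simp [hT])
  let φ : ({b // b ∈ B} → ℝ) →ₗ[ℝ] ℝ := dotProductBilin ℝ ℝ fun b => v b
  have hker : Submodule.span ℝ (Set.range fun q : (T : Set ((k : Fin (K + 1)) × Fin (n k))) =>
      restrictedObs D B q) ≤ LinearMap.ker φ := by
    rw [Submodule.span_le]
    rintro _ ⟨q, rfl⟩
    exact (dotProduct_restrictedObs hv _).trans (hcon q (hTA q.2))
  have hz : ∀ x : {b // b ∈ B} → ℝ, (fun b : {b // b ∈ B} => v b) ⬝ᵥ x = 0 := fun x =>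
    LinearMap.mem_ker.1 (hker (hspan ▸ Submodule.mem_top))
  refine hv0 (funext fun j => ?_)
  by_cases hj : j ∈ B
  · exact congrFun (dotProduct_eq_zero _ hz) ⟨j, hj⟩
  · exact hv j hj

/-- A linear functional may be prescribed freely on independent vectors. Taking y to be coordinate i
yields an exact regression. -/
lemma exists_dotProduct_eq_of_inGeneralPosition (hD : InGeneralPosition D B)
    (hB : ∑ k ∈ A, n k ≤ B.card) (y : (k : Fin (K + 1)) × Fin (n k) → ℝ) :
    ∃ a : Fin p → ℝ, (∀ j, j ∉ B → a j = 0) ∧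
      ∀ q ∈ obsIndex n A, a ⬝ᵥ (D q.1 q.2).ofLp = y q := by
  have hli : LinearIndependent ℝ fun q : ((obsIndex n A : Finset _) : Set ((k : Fin (K + 1)) × Fin (n k))) =>
      restrictedObs D B q :=
    hD (obsIndex n A) (by rwa [card_obsIndex])
  obtain ⟨g, hg⟩ := LinearMap.exists_extend ((Module.Basis.span hli).constr ℝ fun q => y q)
  have hgq : ∀ q : ((obsIndex n A : Finset _) : Set ((k : Fin (K + 1)) × Fin (n k))),
      g (restrictedObs D B q) = y q := fun q => by
    have h1 := (Module.Basis.span hli).constr_basis ℝ (fun q => y q) q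
    rw [← hg] at h1
    simpa [Module.Basis.span_apply] using h1
  set a : Fin p → ℝ := fun j => if hj : j ∈ B then g (Pi.single ⟨j, hj⟩ 1) else 0 with ha
  have ha0 : ∀ j, j ∉ B → a j = 0 := fun j hj => by simp [ha, hj]
  refine ⟨a, ha0, fun q hq => ?_⟩
  rw [← dotProduct_restrictedObs ha0, ← hgq ⟨q, hq⟩]
  conv_rhs => rw [← Finset.univ_sum_single (restrictedObs D B q), map_sum]
  refine Finset.sum_congr rfl fun b _ => ?_
  rw [show Pi.single b (restrictedObs D B q b) =
      restrictedObs D B q b • Pi.single b (1 : ℝ) by rw [← Pi.single_smul]; simp,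
    map_smul, smul_eq_mul, mul_comm]
  simp [ha]

/-- Evaluation against the observations is injective on vectors supported on B, since a kernel
vector would have zero quadratic form. -/
lemma card_le_of_posDef (hA : 0 < ∑ k ∈ A, (n k : ℝ))
    (h : (principal (pooledCov D A) B).PosDef) : B.card ≤ ∑ k ∈ A, n k := by
  classical
  let f : ({b // b ∈ B} → ℝ) →ₗ[ℝ] (obsIndex n A → ℝ) :=
    LinearMap.pi fun q => (dotProductBilin ℝ ℝ).flip (restrictedObs D B q)
  have hf : Function.Injective f := by
    rw [injective_iff_map_eq_zero]
    intro x hx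
    set v : Fin p → ℝ := fun j => if hj : j ∈ B then x ⟨j, hj⟩ else 0 with hvdef
    have hv : ∀ j, j ∉ B → v j = 0 := fun j hj => by simp [hvdef, hj]
    have hxv : x = fun j : {a // a ∈ B} => v j := by
      ext j
      simp [hvdef]
    by_contra hx0
    have hv0 : v ≠ 0 := fun h0 => hx0 (by rw [hxv, h0]; rfl)
    obtain ⟨q, hq, hne⟩ := (quadForm_pooledCov_pos hA).1 (quadForm_pos h hv hv0)
    rw [← dotProduct_restrictedObs hv, ← hxv] at hne
    exact hne (congrFun hx ⟨q, hq⟩)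
  have := LinearMap.finrank_le_finrank_of_injective hf
  simpa [card_obsIndex] using this

/-- If a block of structural equations fits its data exactly, then the likelihood is unbounded. -/
lemma not_isMLE_of_exact_fit (hG : IsDAG G) (hI : I 0 = ∅) (hn : ∀ k, 0 < n k)
    {k₀ : Fin (K + 1)} {i₀ : Fin p} {a : Fin p → ℝ} (ha : ∀ j, j ∉ pa G i₀ → a j = 0)
    (hfit : ∀ l ∈ block I k₀ i₀, ∀ j, equationRow i₀ a ⬝ᵥ (D l j).ofLp = 0)
    (S : Fin (K + 1) → Matrix (Fin p) (Fin p) ℝ) : ¬ IsMLE G I D S := by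
  classical
  intro hS
  obtain ⟨L, w, h, rfl⟩ := mem_model_iff.1 hS.1
  have hmin := (isMLE_structuralCov_iff hG h).1 hS
  set A := block I k₀ i₀ with hA
  set N : ℝ := ∑ k ∈ A, (n k : ℝ) with hN
  have hNpos : 0 < N := block_pos hn k₀ i₀
  set c := ∑ k ∈ A, equationLoss D k i₀ (L k i₀) (w k i₀) with hc
  -- With an exact fit the block loss is N log v; this v makes it c - 1, strictly below the current
  -- loss c.
  set v := Real.exp ((c - 1) / N) with hv
  let L' : Fin (K + 1) → Matrix (Fin p) (Fin p) ℝ :=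
    fun k i => if i = i₀ ∧ k ∈ A then a else L k i
  let w' : Fin (K + 1) → Fin p → ℝ := fun k i => if i = i₀ ∧ k ∈ A then v else w k i
  -- The experiments not targeting i₀ lie all inside or all outside the block, so altering the block
  -- alone stays in the model.
  have hshare : ∀ k, i₀ ∉ I k → (k ∈ A ↔ 0 ∈ A) := fun k hk => by
    have hb : block I k i₀ = block I 0 i₀ := by simp [block, hk, hI]
    constructor
    · intro hkA
      rw [hA, ← block_eq_of_mem hkA, hb]
      exact self_mem_block 0 i₀
    · intro h0A
      rw [hA, ← block_eq_of_mem h0A, ← hb]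
      exact self_mem_block k i₀
  have h' : IsModelParam G I L' w' := by
    refine ⟨fun k => ⟨fun i j hij => ?_, fun i => ?_⟩, fun k i hi => ?_⟩
    · simp only [L']
      split_ifs with hcase
      · exact ha j (by rw [mem_pa, ← hcase.1]; exact hij)
      · exact (h.1 k).1 i j hij
    · simp only [w']
      split_ifs
      · exact Real.exp_pos _
      · exact (h.1 k).2 i
    · obtain ⟨h1, h2⟩ := h.2 k i hi
      by_cases hcase : i = i₀
      · subst hcase
        simp only [L', w', hshare k hi]
        split_ifs
        · exact ⟨fun _ => rfl, rfl⟩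
        · exact ⟨h1, h2⟩
      · simp only [L', w', hcase, false_and, if_false]
        exact ⟨h1, h2⟩
  have hle := hmin L' w' h'
  have hdiff : ∑ k, ∑ i, equationLoss D k i (L' k i) (w' k i) =
      ∑ k, ∑ i, equationLoss D k i (L k i) (w k i) +
        (∑ k ∈ A, equationLoss D k i₀ a v - c) := by
    rw [← sub_eq_iff_eq_add', ← Finset.sum_sub_distrib, hc, ← Finset.sum_sub_distrib,
      ← Finset.sum_subset (Finset.subset_univ A)]
    · refine Finset.sum_congr rfl fun k hk => ?_
      rw [← Finset.sum_sub_distrib, Finset.sum_eq_single i₀]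
      · simp [L', w', hk]
      · intro i _ hi
        simp [L', w', hi]
      · simp
    · intro k _ hk
      simp [L', w', hk]
  have hloss : ∑ k ∈ A, equationLoss D k i₀ a v = c - 1 := by
    have : ∀ k ∈ A, equationLoss D k i₀ a v = n k * ((c - 1) / N) := fun k hk => by
      rw [equationLoss, Finset.sum_eq_zero fun j _ => by rw [hfit k hk j]; simp, hv,
        Real.log_exp]
      simp
    rw [Finset.sum_congr rfl this, ← Finset.sum_mul, ← hN, mul_div_cancel₀ _ hNpos.ne']
  rw [hdiff, hloss] at hle
  linarith

lemma familyPosDef_of_isMLE (hG : IsDAG G) (hI : I 0 = ∅) (hn : ∀ k, 0 < n k)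
    (hD : ∀ B, InGeneralPosition D B) {S : Fin (K + 1) → Matrix (Fin p) (Fin p) ℝ}
    (hS : IsMLE G I D S) : FamilyPosDef G I D := by
  rw [familyPosDef_iff]
  intro k i
  by_contra hcon
  have hlt : ∑ l ∈ block I k i, n l < (fa G i).card := by
    by_contra! hle
    exact hcon (posDef_of_inGeneralPosition (block_pos hn k i) (hD _) hle)
  rw [fa, Finset.card_insert_of_notMem (hG.notMem_pa i)] at hlt
  -- Fewer than |pa(i)| + 1 observations means at most |pa(i)|, so the parents interpolate
  -- coordinate i.
  obtain ⟨a, ha, hfit⟩ := exists_dotProduct_eq_of_inGeneralPosition (hD (pa G i))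
    (Nat.lt_succ_iff.1 hlt) fun q => D q.1 q.2 i
  refine not_isMLE_of_exact_fit hG hI hn (k₀ := k) ha (fun l hl j => ?_) S hS
  rw [equationRow, sub_dotProduct, hfit ⟨l, j⟩ (by simpa [obsIndex] using hl)]
  simp

lemma familyPosDef_of_sampleSize (hn : ∀ k, 0 < n k) (hD : ∀ B, InGeneralPosition D B)
    (h : ∀ k i, (fa G i).card ≤ ∑ l ∈ block I k i, n l) : FamilyPosDef G I D :=
  familyPosDef_iff.2 fun k i => posDef_of_inGeneralPosition (block_pos hn k i) (hD _) (h k i)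

lemma sampleSize_of_familyPosDef (hn : ∀ k, 0 < n k) (hD : FamilyPosDef G I D)
    (k : Fin (K + 1)) (i : Fin p) : (fa G i).card ≤ ∑ l ∈ block I k i, n l :=
  card_le_of_posDef (block_pos hn k i) (familyPosDef_iff.1 hD k i)

lemma measurable_restrict :
    Measurable fun (x : EuclideanSpace ℝ (Fin p)) (b : {b // b ∈ B}) => x b :=
  measurable_pi_lambda _ fun b => by fun_prop

lemma map_restrict_multivariateGaussian_eq_zero {S : Matrix (Fin p) (Fin p) ℝ} (hS : S.PosDef)
    {W : Submodule ℝ ({b // b ∈ B} → ℝ)} (hW : W ≠ ⊤) :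
    (multivariateGaussian 0 S).map (fun x (b : {b // b ∈ B}) => x b)
      (W : Set ({b // b ∈ B} → ℝ)) = 0 := by
  obtain ⟨c, hc, hcW⟩ := exists_dotProduct_eq_zero_of_ne_top hW
  set v : Fin p → ℝ := fun j => if hj : j ∈ B then c ⟨j, hj⟩ else 0 with hvdef
  have hv : ∀ j, j ∉ B → v j = 0 := fun j hj => by simp [hvdef, hj]
  have hcv : c = fun j : {a // a ∈ B} => v j := by
    ext j
    simp [hvdef]
  have hv0 : v ≠ 0 := fun h0 => hc (by rw [hcv, h0]; rfl)
  rw [Measure.map_apply measurable_restrict W.closed_of_finiteDimensional.measurableSet]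
  refine measure_mono_null (fun x hx => ?_) (multivariateGaussian_hyperplane hS hv0)
  have h1 : c ⬝ᵥ (fun b : {b // b ∈ B} => x b) = 0 := hcW _ hx
  rw [hcv] at h1
  exact (sum_coe_eq_sum_of_support (f := fun j => v j * x j)
    fun j hj => by simp [hv j hj]).symm.trans h1

/-- Only finitely many pairs (B, T) occur, so their null sets can be united. -/
lemma ae_inGeneralPosition {Ω : Type*} [MeasurableSpace Ω] {P : Measure Ω}
    [IsProbabilityMeasure P] {S : Fin (K + 1) → Matrix (Fin p) (Fin p) ℝ}
    (hS : ∀ k, (S k).PosDef)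
    {X : (k : Fin (K + 1)) → Fin (n k) → Ω → EuclideanSpace ℝ (Fin p)}
    (hlaw : ∀ k j, HasLaw (X k j) (multivariateGaussian 0 (S k)) P)
    (hindep : iIndepFun (fun q : (k : Fin (K + 1)) × Fin (n k) => X q.1 q.2) P) :
    ∀ᵐ ω ∂P, ∀ B, InGeneralPosition (fun k j => X k j ω) B := by
  refine ae_all_iff.2 fun B => ae_all_iff.2 fun T => ae_all_iff.2 fun hT => ?_
  have hind := hindep.comp (fun _ x (b : {b // b ∈ B}) => x b) fun _ => measurable_restrict
  refine ae_linearIndepOn (fun q => ?_) hind (fun q W hW => ?_) T ?_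
  · exact measurable_restrict.comp_aemeasurable (hlaw q.1 q.2).aemeasurable
  · rw [← AEMeasurable.map_map_of_aemeasurable measurable_restrict.aemeasurable
      (hlaw q.1 q.2).aemeasurable, (hlaw q.1 q.2).map_eq]
    exact map_restrict_multivariateGaussian_eq_zero (hS q.1) hW
  · rwa [Module.finrank_fintype_fun_eq_card, Fintype.card_coe]

lemma posDef_of_mem_model (hG : IsDAG G) {S : Fin (K + 1) → Matrix (Fin p) (Fin p) ℝ}
    (hS : S ∈ model G I) (k : Fin (K + 1)) : (S k).PosDef := by
  obtain ⟨L, w, h, rfl⟩ := mem_model_iff.1 hS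
  exact structuralCov_posDef hG (h.1 k)

end Data

end GaussianIDAG

/-! ### The main theorem -/

open GaussianIDAG in
theorem mainTheorem7 {p K : ℕ} (G : Digraph (Fin p)) (hG : GaussianIDAG.IsDAG G)
    (I : Fin (K + 1) → Finset (Fin p)) (hI : I 0 = ∅)
    (n : Fin (K + 1) → ℕ) (hn : ∀ k, 0 < n k)
    (S₀ : Fin (K + 1) → Matrix (Fin p) (Fin p) ℝ) (hS₀ : S₀ ∈ GaussianIDAG.model G I)
    {Ω : Type*} [MeasurableSpace Ω] (P : Measure Ω) [IsProbabilityMeasure P]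
    (X : (k : Fin (K + 1)) → Fin (n k) → Ω → EuclideanSpace ℝ (Fin p))
    (hlaw : ∀ k j, HasLaw (X k j) (multivariateGaussian 0 (S₀ k)) P)
    (hindep : iIndepFun (fun q : (k : Fin (K + 1)) × Fin (n k) => X q.1 q.2) P) :
    (∀ D : GaussianIDAG.Data p n, GaussianIDAG.FamilyPosDef G I D →
      (∀ k, (GaussianIDAG.precisionHat G I D k).PosDef) ∧
      ∀ S, GaussianIDAG.IsMLE G I D S ↔
        ∀ k, S k = (GaussianIDAG.precisionHat G I D k)⁻¹) ∧
    (∀ᵐ ω ∂P, ∀ S, GaussianIDAG.IsMLE G I (fun k j => X k j ω) S →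
      GaussianIDAG.FamilyPosDef G I (fun k j => X k j ω) ∧
      ∀ k, (S k).PosDef ∧ (S k)⁻¹ = GaussianIDAG.precisionHat G I (fun k j => X k j ω) k) ∧
    ((∀ᵐ ω ∂P, ∃ S, GaussianIDAG.IsMLE G I (fun k j => X k j ω) S) ↔
      ∀ k, (∀ i ∈ I k, (GaussianIDAG.fa G i).card ≤ n k) ∧
        ∀ i, i ∉ I k →
          (GaussianIDAG.fa G i).card ≤ ∑ l ∈ GaussianIDAG.nonTargeting I i, n l) := by
  have hgen := ae_inGeneralPosition (fun k => posDef_of_mem_model hG hS₀ k) hlaw hindep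
  refine ⟨fun D hD => ⟨posDef_precisionHat hG hI hD, isMLE_iff_of_familyPosDef hG hI hn hD⟩,
    ?_, ?_⟩
  · filter_upwards [hgen] with ω hω S hS
    have hD := familyPosDef_of_isMLE hG hI hn hω hS
    refine ⟨hD, fun k => ?_⟩
    have hpd := posDef_precisionHat hG hI hD k
    rw [(isMLE_iff_of_familyPosDef hG hI hn hD S).1 hS k]
    exact ⟨hpd.inv, nonsing_inv_nonsing_inv _ ((isUnit_iff_isUnit_det _).1 hpd.isUnit)⟩
  · rw [sampleSize_iff]
    constructor
    · intro hex
      -- The sample size condition is deterministic, so a single outcome in general position with an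
      -- MLE suffices.
      obtain ⟨ω, ⟨S, hS⟩, hω⟩ := (hex.and hgen).exists
      exact sampleSize_of_familyPosDef hn (familyPosDef_of_isMLE hG hI hn hω hS)
    · intro hsize
      filter_upwards [hgen] with ω hω
      have hD := familyPosDef_of_sampleSize (I := I) (G := G) hn hω hsize
      exact ⟨_, (isMLE_iff_of_familyPosDef hG hI hn hD _).2 fun _ => rfl⟩
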